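/- **Definitions.** A *foliage tree* $\mathbf F$ on a set $X$ consists of a tree (a partially ordered set of nodes in which the strict predecessors of every node are well-ordered) and, for each node $v$, a set $\mathbf F_v\subseteq X$, the *leaf* at $v$. The *height* of $v$ is the order type of the set of strict predecessors of $v$; the *sons* of $v$ are its immediate successors; a *branch* is a maximal chain of nodes. Let $\mathrm{shoot}_{\mathbf F}(v)$ be the family of all sets $\bigcup_{s\in C}\mathbf F_s$, where $C$ is a cofinite subset of the set of sons of $v$. For families of sets, $\gamma\gg\delta$ ("$\gamma$ $\pi$-refines $\delta$") means that every nonempty $D\in\delta$ contains some nonempty $G\in\gamma$; and $\gamma$ has the FIP if every nonempty finite subfamily of $\gamma$ has nonempty intersection. A foliage tree $\mathbf F$ is a *$\pi$-tree* on a topological space $X$ if 1. its tree of nodes is isomorphic to the tree of finite sequences of natural numbers ordered by extension; 2. every leaf is open in $X$, and the leaf at the least node is $X$; 3. for every node $v$ that is not maximal, $\mathbf F_v$ is the disjoint union of the leaves at the sons of $v$; 4. for every branch $B$, $\bigcap_{v\in B}\mathbf F_v$ is a singleton; 5. for every $p\in X$ and every (not necessarily open) neighbourhood $U$ of $p$ there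 is a node $v$ with $p\in\mathbf F_v$ and $\mathrm{shoot}_{\mathbf F}(v)\gg\{U\}$. In a $\pi$-tree all heights are natural numbers. For $p\in X$ and a neighbourhood $U$ of $p$ put $$\mathrm{rise}_{\mathbf F}(p,U)=\{\mathrm{height}(v): p\in\mathbf F_v\text{ and }\mathrm{shoot}_{\mathbf F}(v)\gg\{U\}\}\subseteq\omega,$$ and let $\mathrm{Rise}_{\mathbf F}(X)$ be the family of all sets $\mathrm{rise}_{\mathbf F}(p,U)$ with $p\in X$ and $U$ a neighbourhood of $p$. **Theorem.** (a) Let $1\le|A|\le\omega$ and, for every $\alpha\in A$, let $\mathbf F(\alpha)$ be a $\pi$-tree on a topological space $X_\alpha$. Suppose that for each $\alpha\in A$ there is a family $\gamma_\alpha\subseteq\mathcal P(\omega)$ such that $|\gamma_\alpha|\le\omega$, $\gamma_\alpha$ has the FIP, and $\gamma_\alpha\gg\mathrm{Rise}_{\mathbf F(\alpha)}(X_\alpha)$. Then the product space $\prod_{\alpha\in A}X_\alpha$ has a $\pi$-tree. (b) Suppose, in addition to the assumptions of (a), that $\mathbf G$ is a $\pi$-tree on a topological space $Y$ and $\mathrm{Rise}_{\mathbf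 G}(Y)$ has the FIP. Then the product space $Y\times\prod_{\alpha\in A}X_\alpha$ also has a $\pi$-tree. -/

import Mathlib

open Set Topology

universe u v

/-- A foliage tree whose leaves are subsets of `X`: a partial order of nodes in which the strict
predecessors of every node are well-ordered (a set-theoretic tree, the *skeleton*), together with a
leaf `leaf x ⊆ X` for each node `x`. -/
structure FoliageTree (X : Type u) where
  Node : Type v
  [order : PartialOrder Node]
  wellOrdered : ∀ x : Node, IsWellOrder (Iio x) (· < ·)
  leaf : Node → Set X

attribute [instance] FoliageTree.order

/-- `γ` has the finite intersection property: every nonempty finite subfamily has nonempty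
intersection. -/
def HasFIP {S : Type*} (γ : Set (Set S)) : Prop :=
  ∀ δ : Set (Set S), δ ⊆ γ → δ.Finite → δ.Nonempty → (⋂₀ δ).Nonempty

/-- `γ ≫ δ`: the family `γ` π-refines the family `δ`. -/
def PiRefines {S : Type*} (γ δ : Set (Set S)) : Prop :=
  ∀ D ∈ δ, D.Nonempty → ∃ G ∈ γ, G.Nonempty ∧ G ⊆ D

namespace FoliageTree

variable {X : Type u}

/-- The height of a node: the order type of the set of its strict predecessors. -/
noncomputable def height (F : FoliageTree.{u, v} X) (x : F.Node) : Ordinal.{v} :=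
  haveI := F.wellOrdered x
  Ordinal.type (fun a b : Iio x => a < b)

/-- The sons (immediate successors) of a node. -/
def sons (F : FoliageTree.{u, v} X) (x : F.Node) : Set F.Node := {s | x ⋖ s}

/-- The union of the leaves at the nodes of `C`. -/
def flesh (F : FoliageTree.{u, v} X) (C : Set F.Node) : Set X := ⋃ x ∈ C, F.leaf x

/-- The family of all `flesh C`, where `C` is a cofinite subset of the set of sons of `x`. -/
def shoot (F : FoliageTree.{u, v} X) (x : F.Node) : Set (Set X) :=
  {W | ∃ C : Set F.Node, C ⊆ F.sons x ∧ (F.sons x \ C).Finite ∧ W = F.flesh C}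

/-- The set of nodes whose leaf contains `p`. -/
def scope (F : FoliageTree.{u, v} X) (p : X) : Set F.Node := {x | p ∈ F.leaf x}

/-- For every branch (maximal chain), the intersection of the leaves along it is a singleton. -/
def HasStrictBranches (F : FoliageTree.{u, v} X) : Prop :=
  Nonempty F.Node ∧
    ∀ B : Set F.Node, IsMaxChain (· ≤ ·) B → ∃ p : X, (⋂ x ∈ B, F.leaf x) = {p}

/-- The leaf at each non-maximal node is the disjoint union of the leaves at its sons. -/
def LocallyStrict (F : FoliageTree.{u, v} X) : Prop :=
  ∀ x : F.Node, ¬ IsMax x →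
    F.leaf x = (⋃ s ∈ F.sons x, F.leaf s) ∧ (F.sons x).PairwiseDisjoint F.leaf

/-- The skeleton is order isomorphic to the tree of finite sequences of natural numbers, ordered by
extension (that is, by the prefix relation). -/
def IsOmegaOmegaTree (F : FoliageTree.{u, v} X) : Prop :=
  Nonempty ((fun x y : F.Node => x ≤ y) ≃r (fun s t : List ℕ => s <+: t))

/-- `rise_F(p, U)`: the heights of the nodes `x` such that `p ∈ F_x` and `shoot_F(x) ≫ {U}`.
Every node of a Baire foliage tree has finite height, so this is taken as a set of naturals. -/
def rise (F : FoliageTree.{u, v} X) (p : X) (U : Set X) : Set ℕ :=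
  {n | ∃ x ∈ F.scope p, PiRefines (F.shoot x) {U} ∧ F.height x = (n : Ordinal.{v})}

variable [TopologicalSpace X]

/-- `F` is a Baire foliage tree on the space `X`. -/
structure IsBaireFoliageTree (F : FoliageTree.{u, v} X) : Prop where
  isOpen_leaf : ∀ x : F.Node, IsOpen (F.leaf x)
  locallyStrict : F.LocallyStrict
  isOmegaOmegaTree : F.IsOmegaOmegaTree
  hasStrictBranches : F.HasStrictBranches
  leaf_root : ∃ r : F.Node, IsBot r ∧ F.leaf r = univ

/-- `F` grows into the space `X`. -/
def GrowsInto (F : FoliageTree.{u, v} X) : Prop :=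
  ∀ p : X, ∀ U ∈ 𝓝 p, ∃ z ∈ F.scope p, PiRefines (F.shoot z) {U}

/-- `F` is a π-tree on the space `X`. -/
structure IsPiTree (F : FoliageTree.{u, v} X) : Prop where
  isBaireFoliageTree : F.IsBaireFoliageTree
  growsInto : F.GrowsInto

/-- `Rise_F(X)`: the family of all `rise_F(p, U)` with `p ∈ X` and `U` a neighbourhood of `p`. -/
def riseFamily (F : FoliageTree.{u, v} X) : Set (Set ℕ) :=
  {R | ∃ p : X, ∃ U ∈ 𝓝 p, R = F.rise p U}

end FoliageTree

/-- The space `X` has a π-tree. (The node set of a π-tree is countable, so nothing is lost by taking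
it in `Type`.) -/
def HasPiTree (X : Type u) [TopologicalSpace X] : Prop :=
  ∃ F : FoliageTree.{u, 0} X, F.IsPiTree

/-!
A π-tree on `X` is the same thing as a continuous bijection `c : X → ω^ω` (the leaves are the
preimages of cylinders) such that every neighbourhood `U` of `p` grows at some `n`: it contains all
`y` with `c y` and `c p` equal below `n` and with `c y n` large. These `n` form the set `rise p U`.

More generally, let the coordinates of a code be indexed by an arbitrary set and revealed in finite
stages, and let `U` grow at stage `k` if it contains all points that agree with `p` before stage `k`
and all of whose coordinates of stage `k` are large. Such a code can be turned into a sequence: a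
stage with at least two coordinates is re-encoded by two numbers, of which the first is the minimum
of its coordinates, so that all of them are large as soon as the first number is large. The
bijection with `ℕ × ℕ` exists because every value is the minimum of infinitely many tuples.

A product is coded by all coordinates of its factors, and a box grows at stage `k` if all its sides
do. Hence it suffices that each side grows at almost every stage. A countable family with the FIP
that π-refines the family of all `rise p U` has an infinite pseudo-intersection `ν 0 < ν 1 < ⋯`, and
revealing the coordinates in the blocks `[ν k, ν (k + 1))` makes every neighbourhood grow at almost
every stage. One further factor may have arbitrary stages, since shrinking a neighbourhood shows
that it grows at infinitely many of them.
-/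

open Filter PiNat

theorem exists_forall_res {α : Type*} {p : List α → Prop} (hnil : p [])
    (hcons : ∀ s, p s → ∃ a, p (a :: s)) : ∃ t : ℕ → α, ∀ n, p (res t n) := by
  choose f hf using hcons
  let S (n : ℕ) : {s // p s} := n.rec ⟨[], hnil⟩ fun _ s => ⟨f s s.2 :: s, hf s s.2⟩
  have hS (n : ℕ) : res (fun n => f (S n).1 (S n).2) n = (S n).1 := by
    induction n with
    | zero => rfl
    | succ n ih => rw [res_succ, ih]
  refine ⟨fun n => f (S n).1 (S n).2, fun n => ?_⟩
  rw [hS]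
  exact (S n).2

theorem res_suffix_res {α : Type*} (t : ℕ → α) : ∀ {m n : ℕ}, m ≤ n → res t m <:+ res t n :=
  fun {_ _} h => Nat.le_induction (List.suffix_refl _)
    (fun _ _ ih => ih.trans (List.suffix_cons _ _)) _ h

theorem mem_of_isMaxChain {P : Type*} [LE P] {B : Set P} (hB : IsMaxChain (· ≤ ·) B) {x : P}
    (hx : ∀ y ∈ B, x ≤ y ∨ y ≤ x) : x ∈ B := by
  rw [hB.2 (hB.1.insert fun y hy _ => hx y hy) (subset_insert x B)]
  exact mem_insert x B

/-- An isomorphism of `P` with the tree of finite sequences in `α`. Sequences are listed with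
the latest entry first, as in `PiNat.res`, so that extending a sequence is `List.cons` and the tree
order is the suffix relation. -/
abbrev SeqIso (P α : Type*) [LE P] :=
  (fun x y : P => x ≤ y) ≃r (fun s t : List α => s <:+ t)

namespace SeqIso

variable {P α : Type*} [PartialOrder P] (e : SeqIso P α)
include e

theorem lt_iff {x y : P} : x < y ↔ e x <:+ e y ∧ (e x).length < (e y).length := by
  rw [lt_iff_le_and_ne, ← e.map_rel_iff, ← e.injective.ne_iff]
  exact and_congr_right fun h => ⟨fun hne => h.length_le.lt_of_ne fun hl => hne (h.eq_of_length hl),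
    fun hl => ne_of_apply_ne List.length hl.ne⟩

theorem exists_cons_le_of_lt {x y : P} (h : x < y) : ∃ a, e.symm (a :: e x) ≤ y := by
  obtain ⟨⟨r, hr⟩, hlt⟩ := e.lt_iff.1 h
  obtain rfl | ⟨r, a, rfl⟩ := r.eq_nil_or_concat
  · simp [← hr] at hlt
  · exact ⟨a, e.map_rel_iff.1 ⟨r, by simp [← hr]⟩⟩

theorem lt_cons (x : P) (a : α) : x < e.symm (a :: e x) :=
  e.lt_iff.2 (by simp)

theorem covBy_iff {x y : P} : x ⋖ y ↔ ∃ a, e y = a :: e x := by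
  constructor
  · intro h
    obtain ⟨a, hay⟩ := e.exists_cons_le_of_lt h.lt
    exact ⟨a, by rw [← hay.eq_of_not_lt (h.2 (e.lt_cons x a)), RelIso.apply_symm_apply]⟩
  · rintro ⟨a, ha⟩
    refine ⟨e.lt_iff.2 (by simp [ha]), fun z hxz hzy => ?_⟩
    have h₁ := (e.lt_iff.1 hxz).2
    have h₂ := (e.lt_iff.1 hzy).2
    rw [ha, List.length_cons] at h₂
    lia

theorem le_total_of_le {x y z : P} (hx : x ≤ z) (hy : y ≤ z) : x ≤ y ∨ y ≤ x := by
  simpa only [e.map_rel_iff] using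
    List.suffix_or_suffix_of_suffix (e.map_rel_iff.2 hx) (e.map_rel_iff.2 hy)

theorem bijOn_length_Iio (x : P) :
    BijOn (fun y => (e y).length) (Iio x) (Iio (e x).length) := by
  refine ⟨fun y hy => (e.lt_iff.1 hy).2, fun y hy z hz hyz => ?_, fun n hn => ?_⟩
  · rcases e.le_total_of_le (le_of_lt hy) (le_of_lt hz) with h | h
    · exact e.injective ((e.map_rel_iff.2 h).eq_of_length hyz)
    · exact (e.injective ((e.map_rel_iff.2 h).eq_of_length hyz.symm)).symm
  · have hn : n < (e x).length := hn
    have hlen : ((e x).drop ((e x).length - n)).length = n := by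
      rw [List.length_drop]
      lia
    exact ⟨e.symm ((e x).drop ((e x).length - n)),
      e.lt_iff.2 (by simpa [List.drop_suffix] using by lia), by simpa using hlen⟩

theorem isWellOrder_Iio (x : P) : IsWellOrder (Iio x) (· < ·) where
  trichotomous a b hab hba := by
    rcases e.le_total_of_le a.2.le b.2.le with h | h
    · exact (show a ≤ b from h).eq_of_not_lt hab
    · exact ((show b ≤ a from h).eq_of_not_lt hba).symm
  wf := Subrelation.wf (fun h => (e.lt_iff.1 h).2)
    (measure fun a : Iio x => (e a).length).wf

theorem isMaxChain_range_res (t : ℕ → α) :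
    IsMaxChain (· ≤ ·) (range fun n => e.symm (res t n)) := by
  refine ⟨?_, fun B hB hsub => hsub.antisymm fun x hx => ⟨(e x).length, ?_⟩⟩
  · rintro _ ⟨m, rfl⟩ _ ⟨n, rfl⟩ -
    exact (le_total m n).imp (fun h => e.symm.map_rel_iff.2 (res_suffix_res t h))
      fun h => e.symm.map_rel_iff.2 (res_suffix_res t h)
  · have hlen : (e (e.symm (res t (e x).length))).length = (e x).length := by simp
    rcases hB.total hx (hsub ⟨(e x).length, rfl⟩) with h | h
    · exact (e.injective ((e.map_rel_iff.2 h).eq_of_length hlen.symm)).symm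
    · exact e.injective ((e.map_rel_iff.2 h).eq_of_length hlen)

theorem exists_lt_mem_of_isMaxChain [Nonempty α] {B : Set P} (hB : IsMaxChain (· ≤ ·) B) {x : P}
    (hx : x ∈ B) : ∃ y ∈ B, x < y := by
  obtain ⟨a⟩ := ‹Nonempty α›
  by_contra! hmax
  have hlt := e.lt_cons x a
  refine hmax _ (mem_of_isMaxChain hB fun y hy => Or.inr ?_) hlt
  rcases hB.1.total hy hx with h | h
  · exact h.trans hlt.le
  · exact (h.eq_of_not_lt (hmax y hy)) ▸ hlt.le

theorem exists_eq_range_res [Nonempty α] {B : Set P} (hB : IsMaxChain (· ≤ ·) B) :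
    ∃ t : ℕ → α, B = range fun n => e.symm (res t n) := by
  have hnil : e.symm [] ∈ B :=
    mem_of_isMaxChain hB fun y _ => Or.inl (e.map_rel_iff.1 (by simp))
  have hcons (s : List α) (hs : e.symm s ∈ B) : ∃ a, e.symm (a :: s) ∈ B := by
    obtain ⟨y, hy, hsy⟩ := e.exists_lt_mem_of_isMaxChain hB hs
    obtain ⟨a, hay⟩ := e.exists_cons_le_of_lt hsy
    rw [RelIso.apply_symm_apply] at hay
    refine ⟨a, mem_of_isMaxChain hB fun z hz => ?_⟩
    rcases hB.1.total hz hy with h | h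
    · exact e.le_total_of_le hay h
    · exact Or.inl (hay.trans h)
  obtain ⟨t, ht⟩ := exists_forall_res hnil hcons
  exact ⟨t, ((e.isMaxChain_range_res t).2 hB.1 (range_subset_iff.2 ht)).symm⟩

end SeqIso

/-- The sequences extending the finite sequence `s`, which is listed with its latest entry first. -/
def listCylinder {α : Type*} (s : List α) : Set (ℕ → α) := {t | res t s.length = s}

theorem listCylinder_res {α : Type*} (t : ℕ → α) (n : ℕ) :
    listCylinder (res t n) = cylinder t n := by
  rw [cylinder_eq_res, listCylinder, res_length]

theorem mem_listCylinder_cons {α : Type*} {s : List α} {a : α} {t : ℕ → α} :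
    t ∈ listCylinder (a :: s) ↔ t ∈ listCylinder s ∧ t s.length = a := by
  simp [listCylinder, and_comm]

theorem exists_listCylinder_eq_cylinder {α : Type*} [Nonempty α] (s : List α) :
    ∃ t : ℕ → α, listCylinder s = cylinder t s.length := by
  suffices ∃ t : ℕ → α, t ∈ listCylinder s by
    obtain ⟨t, ht⟩ := this
    exact ⟨t, by rw [← listCylinder_res, show res t s.length = s from ht]⟩
  induction s with
  | nil => exact ⟨fun _ => Classical.arbitrary α, rfl⟩
  | cons a s ih =>
    obtain ⟨t, ht⟩ := ih
    refine ⟨Function.update t s.length a, mem_listCylinder_cons.2 ⟨?_, by simp⟩⟩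
    exact (res_eq_res.2 fun i hi => Function.update_of_ne hi.ne _ _).trans ht

theorem iInter_cylinder {α : Type*} (t : ℕ → α) : ⋂ n, cylinder t n = {t} := by
  refine Subset.antisymm (fun u hu => funext fun n => ?_) ?_
  · exact mem_iInter.1 hu (n + 1) n n.lt_succ_self
  · exact singleton_subset_iff.2 (mem_iInter.2 fun n => self_mem_cylinder t n)

theorem exists_eq_preimage_listCylinder {X α : Type*} {L : List α → Set X} (hnil : L [] = univ)
    (hcons : ∀ s, L s = ⋃ a, L (a :: s)) (hdisj : CantorScheme.Disjoint L) :
    ∃ c : X → ℕ → α, ∀ s, L s = c ⁻¹' listCylinder s := by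
  have hpath (p : X) : ∃ t : ℕ → α, ∀ n, p ∈ L (res t n) :=
    exists_forall_res (p := fun s => p ∈ L s) (hnil ▸ mem_univ p) fun s hs =>
      mem_iUnion.1 (hcons s ▸ hs)
  choose c hc using hpath
  refine ⟨c, fun s => ?_⟩
  ext p
  induction s with
  | nil => simp [hnil, listCylinder]
  | cons a s ih =>
    rw [mem_preimage, mem_listCylinder_cons, ← mem_preimage, ← ih]
    have hnext (hs : p ∈ L s) : p ∈ L (c p s.length :: s) := by
      have h := hc p (s.length + 1)
      rwa [res_succ, show res (c p) s.length = s from ih.1 hs] at h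
    refine ⟨fun ha => ?_, fun ⟨hs, ha⟩ => ha ▸ hnext hs⟩
    have hs : p ∈ L s := by
      rw [hcons]
      exact mem_iUnion.2 ⟨a, ha⟩
    exact ⟨hs, (hdisj s).eq fun h => disjoint_left.1 h (hnext hs) ha⟩

/-- The points that agree with `p` in all coordinates of stage below `n`. For the stage function
`id` this is the preimage of `PiNat.cylinder (c p) n`. -/
def stageCylinder {X I : Type*} (stage : I → ℕ) (c : X → I → ℕ) (p : X) (n : ℕ) : Set X :=
  {y | ∀ i, stage i < n → c y i = c p i}

/-- Every point that agrees with `p` in the coordinates of stage below `n`, and all of whose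
coordinates of stage `n` are large, belongs to `U`. For the stage function `id` this translates
`n ∈ rise p U` into codes: a cofinite set of sons amounts to a large `n`-th coordinate. -/
def GrowsAt {X I : Type*} (stage : I → ℕ) (c : X → I → ℕ) (p : X) (U : Set X) (n : ℕ) : Prop :=
  ∃ m, ∀ y ∈ stageCylinder stage c p n, (∀ i, stage i = n → m ≤ c y i) → y ∈ U

theorem growsAt_id_iff {X : Type*} {c : X → ℕ → ℕ} {p : X} {U : Set X} {n : ℕ} :
    GrowsAt id c p U n ↔ ∃ m, ∀ y, c y ∈ cylinder (c p) n → m ≤ c y n → y ∈ U := by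
  simp [GrowsAt, stageCylinder]

/-- The space is coded by sequences indexed by `I`, the coordinates being revealed in finite
stages. -/
structure IsStagedCode {X I : Type*} [TopologicalSpace X] (stage : I → ℕ) (c : X → I → ℕ) :
    Prop where
  bijective : Function.Bijective c
  continuous : Continuous c
  finite_fiber : ∀ k, (stage ⁻¹' {k}).Finite

/-- The tree order on finite sequences listed with their latest entry first. -/
abbrev suffixOrder (α : Type*) : PartialOrder (List α) where
  le s t := s <:+ t
  le_refl := List.suffix_refl
  le_trans _ _ _ := List.IsSuffix.trans
  le_antisymm _ _ := fun h h' => h.eq_of_length (h.length_le.antisymm h'.length_le)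

namespace FoliageTree

variable {X : Type u} {F : FoliageTree.{u, v} X} {e : SeqIso F.Node ℕ} {c : X → ℕ → ℕ}

theorem height_eq_length (e : SeqIso F.Node ℕ) (x : F.Node) :
    F.height x = ((e x).length : Ordinal.{v}) := by
  have := F.wellOrdered x
  let E := (e.bijOn_length_Iio x).equiv
  let _ : Fintype (Iio x) := Fintype.ofEquiv _ E.symm
  rw [height, Ordinal.type_fintype, Fintype.card_congr E, Fintype.card_Iio, Nat.card_Iio]

theorem IsOmegaOmegaTree.nonempty_seqIso (hF : F.IsOmegaOmegaTree) : Nonempty (SeqIso F.Node ℕ) :=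
  let ⟨e⟩ := hF
  ⟨e.trans ⟨List.reverse_involutive.toPerm _, List.reverse_suffix⟩⟩

theorem isOmegaOmegaTree (e : SeqIso F.Node ℕ) : F.IsOmegaOmegaTree :=
  ⟨e.trans ⟨List.reverse_involutive.toPerm _, List.reverse_prefix⟩⟩

/-- The leaves of `F` are the preimages of cylinders under `c`, nodes being identified with finite
sequences by `e`. -/
def IsCodedBy (F : FoliageTree.{u, v} X) (e : SeqIso F.Node ℕ) (c : X → ℕ → ℕ) : Prop :=
  ∀ x, F.leaf x = c ⁻¹' listCylinder (e x)

theorem not_isMax (e : SeqIso F.Node ℕ) (x : F.Node) : ¬ IsMax x :=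
  not_isMax_of_lt (e.lt_cons x 0)

theorem exists_isCodedBy (e : SeqIso F.Node ℕ) (hF : F.LocallyStrict)
    (hroot : F.leaf (e.symm []) = univ) : ∃ c, F.IsCodedBy e c := by
  have hmem (s : List ℕ) (i : ℕ) : e.symm (i :: s) ∈ F.sons (e.symm s) := e.covBy_iff.2 ⟨i, by simp⟩
  have hcons (s : List ℕ) : F.leaf (e.symm s) = ⋃ i, F.leaf (e.symm (i :: s)) := by
    rw [(hF _ (not_isMax e _)).1]
    refine Subset.antisymm (iUnion₂_subset fun y hy => ?_)
      (iUnion_subset fun i => subset_biUnion_of_mem (u := F.leaf) (hmem s i))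
    obtain ⟨i, hi⟩ := e.covBy_iff.1 hy
    rw [RelIso.apply_symm_apply] at hi
    exact subset_iUnion_of_subset i (by rw [← hi, RelIso.symm_apply_apply])
  have hdisj : CantorScheme.Disjoint fun s => F.leaf (e.symm s) := fun s i j hij =>
    (hF _ (not_isMax e _)).2 (hmem s i) (hmem s j) (e.symm.injective.ne (by simpa using hij))
  obtain ⟨c, hc⟩ := exists_eq_preimage_listCylinder hroot hcons hdisj
  exact ⟨c, fun x => by rw [← hc, RelIso.symm_apply_apply]⟩

namespace IsCodedBy

variable (hc : F.IsCodedBy e c)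
include hc

theorem leaf_res (t : ℕ → ℕ) (n : ℕ) : F.leaf (e.symm (res t n)) = c ⁻¹' cylinder t n := by
  rw [hc, RelIso.apply_symm_apply, listCylinder_res]

theorem mem_leaf_son {x y : F.Node} {i : ℕ} (hy : e y = i :: e x) {p : X} :
    p ∈ F.leaf y ↔ p ∈ F.leaf x ∧ c p (e x).length = i := by
  rw [hc, hc, hy, mem_preimage, mem_listCylinder_cons, mem_preimage]

theorem locallyStrict : F.LocallyStrict := by
  refine fun x _ => ⟨Subset.antisymm (fun p hp => ?_) (iUnion₂_subset fun y hy => ?_), ?_⟩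
  · have hy : e (e.symm (c p (e x).length :: e x)) = c p (e x).length :: e x := by simp
    exact mem_biUnion (e.covBy_iff.2 ⟨_, hy⟩) ((hc.mem_leaf_son hy).2 ⟨hp, rfl⟩)
  · obtain ⟨i, hi⟩ := e.covBy_iff.1 hy
    exact fun p hp => ((hc.mem_leaf_son hi).1 hp).1
  · intro y hy z hz hyz
    obtain ⟨i, hi⟩ := e.covBy_iff.1 hy
    obtain ⟨j, hj⟩ := e.covBy_iff.1 hz
    refine disjoint_left.2 fun p hpy hpz => hyz (e.injective ?_)
    rw [hi, hj, ← ((hc.mem_leaf_son hi).1 hpy).2, ((hc.mem_leaf_son hj).1 hpz).2]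

theorem hasStrictBranches_iff : F.HasStrictBranches ↔ Function.Bijective c := by
  have hbranch (t : ℕ → ℕ) : ⋂ x ∈ range fun n => e.symm (res t n), F.leaf x = c ⁻¹' {t} := by
    simp only [biInter_range, hc.leaf_res, ← preimage_iInter, iInter_cylinder]
  rw [Function.bijective_iff_existsUnique]
  constructor
  · rintro ⟨-, hF⟩ t
    obtain ⟨p, hp⟩ := hF _ (e.isMaxChain_range_res t)
    rw [hbranch, eq_singleton_iff_unique_mem] at hp
    exact ⟨p, hp⟩
  · refine fun h => ⟨⟨e.symm []⟩, fun B hB => ?_⟩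
    obtain ⟨t, rfl⟩ := e.exists_eq_range_res hB
    obtain ⟨p, hp⟩ := h t
    exact ⟨p, (hbranch t).trans (eq_singleton_iff_unique_mem.2 hp)⟩

theorem isOpen_leaf_iff [TopologicalSpace X] : (∀ x, IsOpen (F.leaf x)) ↔ Continuous c := by
  constructor
  · refine fun h => (isTopologicalBasis_cylinders fun _ => ℕ).continuous_iff.2 ?_
    rintro _ ⟨t, n, rfl⟩
    exact hc.leaf_res t n ▸ h _
  · intro h x
    obtain ⟨t, ht⟩ := exists_listCylinder_eq_cylinder (e x)
    rw [hc, ht]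
    exact (isOpen_cylinder _ t _).preimage h

theorem piRefines_shoot_iff (hsurj : Function.Surjective c) {x : F.Node} {U : Set X}
    (hU : U.Nonempty) : PiRefines (F.shoot x) {U} ↔
      ∃ m, ∀ y ∈ F.leaf x, m ≤ c y (e x).length → y ∈ U := by
  have hson (i : ℕ) : e (e.symm (i :: e x)) = i :: e x := e.apply_symm_apply _
  constructor
  · intro h
    obtain ⟨_, ⟨C, -, hfin, rfl⟩, -, hCU⟩ := h U rfl hU
    have hinj : Function.Injective fun i => e.symm (i :: e x) :=
      e.symm.injective.comp fun i j hij => (List.cons.inj hij).1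
    obtain ⟨m, hm⟩ := (hfin.preimage hinj.injOn).bddAbove
    refine ⟨m + 1, fun y hy hmy => ?_⟩
    have hC : e.symm (c y (e x).length :: e x) ∈ C := by
      by_contra hC
      exact (Nat.lt_of_succ_le hmy).not_ge (hm ⟨e.covBy_iff.2 ⟨_, hson _⟩, hC⟩)
    exact hCU (mem_biUnion hC ((hc.mem_leaf_son (hson _)).2 ⟨hy, rfl⟩))
  · rintro ⟨m, hm⟩ _ rfl -
    let C : Set F.Node := (fun i => e.symm (i :: e x)) '' Ici m
    have hCsons : C ⊆ F.sons x := image_subset_iff.2 fun i _ => e.covBy_iff.2 ⟨i, hson i⟩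
    have hfin : (F.sons x \ C).Finite := by
      refine ((finite_Iio m).image fun i => e.symm (i :: e x)).subset fun y ⟨hy, hyC⟩ => ?_
      obtain ⟨i, hi⟩ := e.covBy_iff.1 hy
      have hyi : e.symm (i :: e x) = y := by rw [← hi, e.symm_apply_apply]
      exact ⟨i, mem_Iio.2 (not_le.1 fun hmi => hyC ⟨i, hmi, hyi⟩), hyi⟩
    obtain ⟨t, ht⟩ := exists_listCylinder_eq_cylinder (m :: e x)
    obtain ⟨q, hq⟩ := hsurj t
    refine ⟨_, ⟨C, hCsons, hfin, rfl⟩, ⟨q, mem_biUnion ⟨m, self_mem_Ici, rfl⟩ ?_⟩, ?_⟩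
    · rw [hc, hson, mem_preimage, ht, hq]
      exact self_mem_cylinder t _
    · refine iUnion₂_subset ?_
      rintro _ ⟨i, hi, rfl⟩ y hy
      obtain ⟨hyx, rfl⟩ := (hc.mem_leaf_son (hson i)).1 hy
      exact hm y hyx hi

theorem mem_rise_iff (hsurj : Function.Surjective c) {p : X} {U : Set X} (hp : p ∈ U) {n : ℕ} :
    n ∈ F.rise p U ↔ GrowsAt id c p U n := by
  have hleaf : p ∈ F.leaf (e.symm (res (c p) n)) := hc.leaf_res _ _ ▸ self_mem_cylinder (c p) n
  have hgrows : PiRefines (F.shoot (e.symm (res (c p) n))) {U} ↔ GrowsAt id c p U n := by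
    rw [hc.piRefines_shoot_iff hsurj ⟨p, hp⟩, hc.leaf_res, growsAt_id_iff, e.apply_symm_apply,
      res_length]
    rfl
  rw [← hgrows]
  constructor
  · rintro ⟨x, hpx, hx, hxn⟩
    rw [height_eq_length e, Nat.cast_inj] at hxn
    have hres : res (c p) (e x).length = e x := (hc x).subset hpx
    rwa [← hxn, hres, e.symm_apply_apply]
  · exact fun h => ⟨_, hleaf, h, by rw [height_eq_length e, e.apply_symm_apply, res_length]⟩

end IsCodedBy

theorem rise_nonempty (e : SeqIso F.Node ℕ) [TopologicalSpace X] (hF : F.GrowsInto) {p : X}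
    {U : Set X} (hU : U ∈ 𝓝 p) : (F.rise p U).Nonempty :=
  let ⟨x, hpx, hx⟩ := hF p U hU
  ⟨(e x).length, x, hpx, hx, height_eq_length e x⟩

theorem IsPiTree.exists_isCodedBy [TopologicalSpace X] (hF : F.IsPiTree) :
    ∃ e c, F.IsCodedBy e c := by
  obtain ⟨e⟩ := hF.isBaireFoliageTree.isOmegaOmegaTree.nonempty_seqIso
  obtain ⟨r, hr, hroot⟩ := hF.isBaireFoliageTree.leaf_root
  have hr_eq : r = e.symm [] := (hr _).antisymm (e.map_rel_iff.1 (by simp))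
  exact ⟨e, FoliageTree.exists_isCodedBy e hF.isBaireFoliageTree.locallyStrict (hr_eq ▸ hroot)⟩

theorem IsPiTree.exists_isStagedCode [TopologicalSpace X] (hF : F.IsPiTree) :
    ∃ c, IsStagedCode id c ∧ ∀ p, ∀ U ∈ 𝓝 p,
      (F.rise p U).Nonempty ∧ ∀ n, n ∈ F.rise p U ↔ GrowsAt id c p U n := by
  obtain ⟨e, c, hc⟩ := hF.exists_isCodedBy
  have hbij := hc.hasStrictBranches_iff.1 hF.isBaireFoliageTree.hasStrictBranches
  refine ⟨c, ⟨hbij, hc.isOpen_leaf_iff.1 hF.isBaireFoliageTree.isOpen_leaf, fun k => ?_⟩, ?_⟩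
  · rw [preimage_id]
    exact finite_singleton k
  · exact fun p U hU => ⟨rise_nonempty e hF.growsInto hU,
      fun n => hc.mem_rise_iff hbij.2 (mem_of_mem_nhds hU)⟩

/-- The foliage tree on the finite sequences of natural numbers whose leaves are the preimages of
cylinders under `c`. -/
def ofCode (c : X → ℕ → ℕ) : FoliageTree.{u, 0} X where
  Node := List ℕ
  order := suffixOrder ℕ
  wellOrdered := @SeqIso.isWellOrder_Iio _ _ (suffixOrder ℕ) (RelIso.refl _)
  leaf s := c ⁻¹' listCylinder s

end FoliageTree

theorem hasPiTree_of_growsAt {X : Type u} [TopologicalSpace X] {c : X → ℕ → ℕ}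
    (hbij : Function.Bijective c) (hcont : Continuous c)
    (hgrow : ∀ p, ∀ U ∈ 𝓝 p, ∃ n, GrowsAt id c p U n) : HasPiTree X := by
  let F := FoliageTree.ofCode c
  let e : SeqIso F.Node ℕ := RelIso.refl _
  have hc : F.IsCodedBy e c := fun _ => rfl
  refine ⟨F, ⟨?_, ?_⟩⟩
  · exact
      { isOpen_leaf := hc.isOpen_leaf_iff.2 hcont
        locallyStrict := hc.locallyStrict
        isOmegaOmegaTree := FoliageTree.isOmegaOmegaTree e
        hasStrictBranches := hc.hasStrictBranches_iff.2 hbij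
        leaf_root := ⟨e.symm [], fun s => s.nil_suffix, eq_univ_of_forall fun _ => rfl⟩ }
  · intro p U hU
    obtain ⟨n, hn⟩ := hgrow p U hU
    obtain ⟨x, hpx, hx, -⟩ := (hc.mem_rise_iff hbij.2 (mem_of_mem_nhds hU)).2 hn
    exact ⟨x, hpx, hx⟩

theorem exists_equiv_prod_nat_fst_eq {D : Type*} [Countable D] {h : D → ℕ}
    (hh : ∀ n, (h ⁻¹' {n}).Infinite) : ∃ e : D ≃ ℕ × ℕ, ∀ d, (e d).1 = h d := by
  have hfiber (n : ℕ) : Nonempty ({d // h d = n} ≃ ℕ) :=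
    have : Infinite {d // h d = n} := (hh n).to_subtype
    nonempty_equiv_of_countable
  exact ⟨(Equiv.sigmaFiberEquiv h).symm.trans
    ((Equiv.sigmaCongrRight fun n => (hfiber n).some).trans (Equiv.sigmaEquivProd ℕ ℕ)),
    fun _ => rfl⟩

theorem infinite_setOf_iInf_eq {E : Type*} [Nontrivial E] (n : ℕ) :
    {f : E → ℕ | ⨅ i, f i = n}.Infinite := by
  classical
  obtain ⟨a, b, hab⟩ := exists_pair_ne E
  let f (k : ℕ) : E → ℕ := Function.update (fun _ => n) a (n + k)
  have hf : Function.Injective f := fun k l hkl => by simpa [f] using congr_fun hkl a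
  refine infinite_of_injective_forall_mem hf fun k => le_antisymm ?_ (le_ciInf fun i => ?_)
  · exact (ciInf_le' (f k) b).trans_eq (Function.update_of_ne hab.symm _ _)
  · by_cases hi : i = a <;> simp [f, hi]

/-- A sequence of pairs read as one sequence, the `k`-th pair taking positions `2 * k` and
`2 * k + 1`. -/
def interleave {α : Type*} : (ℕ → α × α) ≃ (ℕ → α) :=
  (Equiv.arrowProdEquivProdArrow ℕ (fun _ => α) fun _ => α).trans
    ((Equiv.sumArrowEquivProdArrow ℕ ℕ α).symm.trans
      (Equiv.natSumNatEquivNat.arrowCongr (Equiv.refl α)))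

theorem interleave_two_mul {α : Type*} (f : ℕ → α × α) (k : ℕ) :
    interleave f (2 * k) = (f k).1 := by
  have hk : Equiv.natSumNatEquivNat.symm (2 * k) = Sum.inl k :=
    (Equiv.symm_apply_eq _).2 (by simp)
  simp [interleave, hk]

theorem interleave_two_mul_add_one {α : Type*} (f : ℕ → α × α) (k : ℕ) :
    interleave f (2 * k + 1) = (f k).2 := by
  have hk : Equiv.natSumNatEquivNat.symm (2 * k + 1) = Sum.inr k :=
    (Equiv.symm_apply_eq _).2 (by simp)
  simp [interleave, hk]

theorem continuous_interleave {α : Type*} [TopologicalSpace α] :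
    Continuous (interleave : (ℕ → α × α) → ℕ → α) := by
  refine continuous_pi fun n => ?_
  obtain ⟨k, rfl | rfl⟩ := n.even_or_odd'
  · simpa only [interleave_two_mul] using (continuous_apply k).fst
  · simpa only [interleave_two_mul_add_one] using (continuous_apply k).snd

theorem exists_renumbering {I : Type*} {stage : I → ℕ} (hfin : ∀ k, (stage ⁻¹' {k}).Finite)
    (hnt : ∀ k, (stage ⁻¹' {k}).Nontrivial) :
    ∃ r : (I → ℕ) ≃ (ℕ → ℕ), Continuous r ∧
      (∀ u k, r u (2 * k) = ⨅ i : {i // stage i = k}, u i) ∧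
      ∀ u v k, r u ∈ cylinder (r v) (2 * k) → ∀ i, stage i < k → u i = v i := by
  have hfin (k : ℕ) : Finite {i // stage i = k} := (hfin k).to_subtype
  have hnt (k : ℕ) : Nontrivial {i // stage i = k} := (hnt k).coe_sort
  choose w hw using fun k =>
    exists_equiv_prod_nat_fst_eq (infinite_setOf_iInf_eq (E := {i // stage i = k}))
  let split : (I → ℕ) ≃ ∀ k, {i // stage i = k} → ℕ :=
    ((Equiv.sigmaFiberEquiv stage).symm.arrowCongr (Equiv.refl ℕ)).trans
      (Equiv.piCurry fun (k : ℕ) (_ : {i // stage i = k}) => ℕ)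
  let pairs : (I → ℕ) ≃ (ℕ → ℕ × ℕ) := split.trans (Equiv.piCongrRight w)
  refine ⟨pairs.trans interleave, continuous_interleave.comp ?_, fun u k => ?_, ?_⟩
  · have hsplit (k : ℕ) : Continuous fun u => split u k :=
      continuous_pi fun i => continuous_apply i.1
    exact continuous_pi fun k => continuous_of_discreteTopology.comp (hsplit k)
  · exact (interleave_two_mul _ k).trans (hw k _)
  · intro u v k huv i hi
    have hpair : pairs u (stage i) = pairs v (stage i) := by
      have h₁ := huv (2 * stage i) (by lia)
      have h₂ := huv (2 * stage i + 1) (by lia)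
      exact Prod.ext (by simpa [interleave_two_mul] using h₁)
        (by simpa [interleave_two_mul_add_one] using h₂)
    exact congr_fun ((w (stage i)).injective hpair) ⟨i, rfl⟩

theorem IsStagedCode.hasPiTree {X : Type u} [TopologicalSpace X] {I : Type*} {stage : I → ℕ}
    {c : X → I → ℕ} (hc : IsStagedCode stage c) (hnt : ∀ k, (stage ⁻¹' {k}).Nontrivial)
    (hgrow : ∀ p, ∀ U ∈ 𝓝 p, ∃ k, GrowsAt stage c p U k) : HasPiTree X := by
  obtain ⟨r, hr, hmin, hagree⟩ := exists_renumbering hc.finite_fiber hnt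
  refine hasPiTree_of_growsAt (c := r ∘ c) (r.bijective.comp hc.bijective) (hr.comp hc.continuous)
    fun p U hU => ?_
  obtain ⟨k, m, hm⟩ := hgrow p U hU
  refine ⟨2 * k, growsAt_id_iff.2 ⟨m, fun y hy hmy => hm y (hagree _ _ k hy) fun i hi => ?_⟩⟩
  rw [Function.comp_apply, hmin] at hmy
  exact hmy.trans (ciInf_le' (fun i : {i // stage i = k} => c y i) ⟨i, hi⟩)

theorem GrowsAt.mono {X I : Type*} {stage : I → ℕ} {c : X → I → ℕ} {p : X} {U V : Set X} {n : ℕ}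
    (h : GrowsAt stage c p U n) (hUV : U ⊆ V) : GrowsAt stage c p V n :=
  let ⟨m, hm⟩ := h
  ⟨m, fun y hy hmy => hUV (hm y hy hmy)⟩

theorem IsStagedCode.finite_preimage {X I : Type*} [TopologicalSpace X] {stage : I → ℕ}
    {c : X → I → ℕ} (hc : IsStagedCode stage c) {s : Set ℕ} (hs : s.Finite) :
    (stage ⁻¹' s).Finite :=
  hs.preimage' fun k _ => hc.finite_fiber k

theorem exists_injective_nat_apply_eq_zero {A : Type*} [Countable A] (a : A) :
    ∃ f : A → ℕ, f.Injective ∧ f a = 0 := by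
  classical
  obtain ⟨f⟩ := nonempty_embedding_nat A
  exact ⟨f.setValue a 0, (f.setValue a 0).injective, f.setValue_eq a 0⟩

section Pi

variable {A : Type*} {X : A → Type*} {I : A → Type*} {enc : A → ℕ} {stage : ∀ α, I α → ℕ}
  {c : ∀ α, X α → I α → ℕ}

/-- The code of a point of a product: all coordinates of the codes of its components. -/
def piCode (c : ∀ α, X α → I α → ℕ) (x : ∀ α, X α) (i : Σ α, I α) : ℕ := c i.1 (x i.1) i.2

/-- The stages for `piCode`. Delaying the factor `α` until stage `enc α` keeps the stages finite. -/
def piStage (enc : A → ℕ) (stage : ∀ α, I α → ℕ) (i : Σ α, I α) : ℕ :=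
  max (enc i.1) (stage i.1 i.2)

theorem bijective_piCode (hc : ∀ α, Function.Bijective (c α)) : Function.Bijective (piCode c) :=
  (Equiv.piCurry fun α (_ : I α) => ℕ).symm.bijective.comp (Function.Bijective.piMap hc)

theorem finite_piStage_preimage (henc : enc.Injective)
    (hstage : ∀ α k, (stage α ⁻¹' Iic k).Finite) (k : ℕ) :
    (piStage enc stage ⁻¹' {k}).Finite := by
  refine (((finite_Iic k).preimage henc.injOn).biUnion fun α _ =>
    (hstage α k).image (Sigma.mk α)).subset ?_
  rintro ⟨α, i⟩ hi
  obtain ⟨hα, hi⟩ := max_le_iff.1 hi.le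
  exact mem_biUnion hα ⟨i, hi, rfl⟩

theorem nontrivial_piStage_preimage {α : A} (hα : enc α = 0) {k : ℕ}
    (h : (stage α ⁻¹' {k}).Nontrivial) : (piStage enc stage ⁻¹' {k}).Nontrivial := by
  obtain ⟨i, hi, j, hj, hij⟩ := h
  have hmem {i : I α} (hi : stage α i = k) : piStage enc stage ⟨α, i⟩ = k := by
    simp [piStage, hα, hi]
  exact ⟨⟨α, i⟩, hmem hi, ⟨α, j⟩, hmem hj, by simpa using hij⟩

theorem GrowsAt.pi {p : ∀ α, X α} {J : Finset A} {U : ∀ α, Set (X α)} {k : ℕ}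
    (henc : ∀ α ∈ J, enc α < k) (h : ∀ α ∈ J, GrowsAt (stage α) (c α) (p α) (U α) k) :
    GrowsAt (piStage enc stage) (piCode c) p ((J : Set A).pi U) k := by
  choose! m hm using h
  refine ⟨J.sup m, fun y hy hmy α hα => hm α hα _ (fun i hi => ?_) fun i hi => ?_⟩
  · exact hy ⟨α, i⟩ (max_lt (henc α hα) hi)
  · exact (Finset.le_sup hα).trans (hmy ⟨α, i⟩ (hi ▸ max_eq_right (hi.symm ▸ (henc α hα).le)))

variable [∀ α, TopologicalSpace (X α)]

theorem IsStagedCode.pi (henc : enc.Injective) (hc : ∀ α, IsStagedCode (stage α) (c α)) :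
    IsStagedCode (piStage enc stage) (piCode c) where
  bijective := bijective_piCode fun α => (hc α).bijective
  continuous := continuous_pi fun i =>
    ((continuous_apply i.2).comp (hc i.1).continuous).comp (continuous_apply i.1)
  finite_fiber := finite_piStage_preimage henc fun α k => (hc α).finite_preimage (finite_Iic k)

theorem eventually_growsAt_pi
    (h : ∀ α p, ∀ U ∈ 𝓝 p, ∀ᶠ k in atTop, GrowsAt (stage α) (c α) p U k) (p : ∀ α, X α)
    {U : Set (∀ α, X α)} (hU : U ∈ 𝓝 p) :
    ∀ᶠ k in atTop, GrowsAt (piStage enc stage) (piCode c) p U k := by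
  rw [nhds_pi, Filter.mem_pi'] at hU
  obtain ⟨J, V, hV, hVU⟩ := hU
  filter_upwards [(eventually_all_finset J).2 fun α _ => eventually_gt_atTop (enc α),
    (eventually_all_finset J).2 fun α _ => h α (p α) (V α) (hV α)] with k henc hgrow
  exact (GrowsAt.pi henc hgrow).mono hVU

end Pi

section Prod

variable {Y Z I J : Type*} {stageY : J → ℕ} {stageZ : I → ℕ} {c : Y → J → ℕ} {d : Z → I → ℕ}

theorem GrowsAt.prod {p : Y} {q : Z} {V : Set Y} {W : Set Z} {k : ℕ}
    (hV : GrowsAt stageY c p V k) (hW : GrowsAt stageZ d q W k) :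
    GrowsAt (Sum.elim stageY stageZ) (fun x : Y × Z => Sum.elim (c x.1) (d x.2)) (p, q)
      (V ×ˢ W) k := by
  obtain ⟨m, hm⟩ := hV
  obtain ⟨l, hl⟩ := hW
  exact ⟨max m l, fun y hy hmy =>
    ⟨hm _ (fun j hj => hy (.inl j) hj) fun j hj => (le_max_left _ _).trans (hmy (.inl j) hj),
      hl _ (fun i hi => hy (.inr i) hi) fun i hi => (le_max_right _ _).trans (hmy (.inr i) hi)⟩⟩

variable [TopologicalSpace Y] [TopologicalSpace Z]

theorem IsStagedCode.prod (hc : IsStagedCode stageY c) (hd : IsStagedCode stageZ d) :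
    IsStagedCode (Sum.elim stageY stageZ) fun x : Y × Z => Sum.elim (c x.1) (d x.2) where
  bijective :=
    (Equiv.sumArrowEquivProdArrow J I ℕ).symm.bijective.comp (hc.bijective.prodMap hd.bijective)
  continuous := continuous_pi fun
    | .inl j => ((continuous_apply j).comp hc.continuous).comp continuous_fst
    | .inr i => ((continuous_apply i).comp hd.continuous).comp continuous_snd
  finite_fiber k := by
    rw [← Set.image_preimage_inl_union_image_preimage_inr (Sum.elim stageY stageZ ⁻¹' {k})]
    exact ((hc.finite_fiber k).image _).union ((hd.finite_fiber k).image _)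

theorem frequently_growsAt_prod
    (hY : ∀ p, ∀ V ∈ 𝓝 p, ∃ᶠ k in atTop, GrowsAt stageY c p V k)
    (hZ : ∀ q, ∀ W ∈ 𝓝 q, ∀ᶠ k in atTop, GrowsAt stageZ d q W k) (x : Y × Z)
    {U : Set (Y × Z)} (hU : U ∈ 𝓝 x) :
    ∃ᶠ k in atTop,
      GrowsAt (Sum.elim stageY stageZ) (fun x : Y × Z => Sum.elim (c x.1) (d x.2)) x U k := by
  obtain ⟨V, hV, W, hW, hVW⟩ := mem_nhds_prod_iff.1 hU
  exact ((hY x.1 V hV).and_eventually (hZ x.2 W hW)).mono fun k h => (h.1.prod h.2).mono hVW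

end Prod

section Frequently

variable {X I : Type*} {stage : I → ℕ} {c : X → I → ℕ}

theorem le_of_growsAt_stageCylinder (hc : c.Surjective) (hstage : stage.Surjective) {p : X}
    {M n : ℕ} (h : GrowsAt stage c p (stageCylinder stage c p M) n) : M ≤ n := by
  obtain ⟨m, hm⟩ := h
  by_contra! hn
  obtain ⟨i, hi⟩ := hstage n
  obtain ⟨y, hy⟩ := hc fun j => if stage j < n then c p j else c p j + m + 1
  have hyM : y ∈ stageCylinder stage c p M := by
    refine hm y (fun j hj => by simp [hy, hj]) fun j hj => ?_
    simp only [hy, hj, lt_irrefl, if_false]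
    lia
  have := hyM i (hi.trans_lt hn)
  simp only [hy, hi, lt_irrefl, if_false] at this
  lia

variable [TopologicalSpace X]

theorem IsStagedCode.stageCylinder_mem_nhds (hc : IsStagedCode stage c) (p : X) (n : ℕ) :
    stageCylinder stage c p n ∈ 𝓝 p := by
  have hcoord (i : I) : ∀ᶠ y in 𝓝 p, c y i = c p i :=
    ((IsLocallyConstant.iff_continuous _).2
      ((continuous_apply i).comp hc.continuous)).eventually_eq p
  exact ((hc.finite_preimage (finite_Iio n)).eventually_all).2 fun i _ => hcoord i

theorem IsStagedCode.frequently_growsAt (hc : IsStagedCode stage c) (hstage : stage.Surjective)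
    (h : ∀ p, ∀ U ∈ 𝓝 p, ∃ k, GrowsAt stage c p U k) (p : X) {U : Set X} (hU : U ∈ 𝓝 p) :
    ∃ᶠ k in atTop, GrowsAt stage c p U k := by
  refine frequently_atTop.2 fun M => ?_
  obtain ⟨k, hk⟩ := h p _ (inter_mem hU (hc.stageCylinder_mem_nhds p M))
  exact ⟨k, le_of_growsAt_stageCylinder hc.bijective.2 hstage (hk.mono inter_subset_right),
    hk.mono inter_subset_left⟩

end Frequently

theorem exists_strictMono_eventually_mem {γ : Set (Set ℕ)} (hcount : γ.Countable) (hγ : HasFIP γ)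
    (htail : ∀ M, ∃ G ∈ γ, G ⊆ Ici M) :
    ∃ ν : ℕ → ℕ, StrictMono ν ∧ ∀ G ∈ γ, ∀ᶠ k in atTop, ν k ∈ G := by
  have : (generate γ).NeBot := generate_neBot_iff.2 fun δ hδ hfin => by
    rcases δ.eq_empty_or_nonempty with rfl | hne
    · simp
    · exact hγ δ hδ hfin hne
  have : (generate γ).IsCountablyGenerated := ⟨γ, hcount, rfl⟩
  obtain ⟨ν, hν⟩ := exists_seq_tendsto (generate γ)
  have hmem (G : Set ℕ) (hG : G ∈ γ) : ∀ᶠ k in atTop, ν k ∈ G :=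
    hν.eventually_mem (mem_generate_of_mem hG)
  have hatTop : Tendsto ν atTop atTop := tendsto_atTop.2 fun M =>
    let ⟨G, hG, hGM⟩ := htail M
    (hmem G hG).mono fun k hk => hGM hk
  obtain ⟨φ, hφ, hνφ⟩ := strictMono_subseq_of_tendsto_atTop hatTop
  exact ⟨ν ∘ φ, hνφ, fun G hG => hφ.tendsto_atTop.eventually (hmem G hG)⟩

section Blocks

variable {ν : ℕ → ℕ} {i k : ℕ}

/-- The index of the block of `ν` containing `i`: for strictly increasing `ν`, the block of index
`k` is `[ν k, ν (k + 1))`, except that block `0` also contains the numbers below `ν 0`. -/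
def blockIndex (ν : ℕ → ℕ) (i : ℕ) : ℕ := Nat.findGreatest (ν · ≤ i) i

theorem blockIndex_lt_iff (hν : StrictMono ν) (hk : 0 < k) : blockIndex ν i < k ↔ i < ν k := by
  rw [← not_le, ← not_le, not_iff_not]
  refine ⟨fun h => ?_, fun h => Nat.le_findGreatest (hν.le_apply.trans h) h⟩
  exact (hν.monotone h).trans
    (Nat.findGreatest_of_ne_zero (P := (ν · ≤ i)) rfl (hk.trans_le h).ne')

theorem blockIndex_eq (hν : StrictMono ν) (h₁ : ν k ≤ i) (h₂ : i < ν (k + 1)) :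
    blockIndex ν i = k := by
  refine (Nat.lt_succ_iff.1 ((blockIndex_lt_iff hν k.succ_pos).2 h₂)).antisymm ?_
  exact Nat.le_findGreatest (hν.le_apply.trans h₁) h₁

theorem finite_blockIndex_preimage (hν : StrictMono ν) (k : ℕ) :
    (blockIndex ν ⁻¹' {k}).Finite :=
  (finite_Iio (ν (k + 1))).subset fun _ hi =>
    (blockIndex_lt_iff hν k.succ_pos).1 (hi.trans_lt k.lt_succ_self)

theorem nontrivial_blockIndex_preimage (hν : StrictMono ν) (hk : ν k + 2 ≤ ν (k + 1)) :
    (blockIndex ν ⁻¹' {k}).Nontrivial :=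
  ⟨ν k, blockIndex_eq hν le_rfl (by lia), ν k + 1, blockIndex_eq hν (by lia) (by lia), by lia⟩

theorem GrowsAt.blockIndex {X : Type*} {c : X → ℕ → ℕ} {p : X} {U : Set X} (hν : StrictMono ν)
    (hk : 0 < k) (h : GrowsAt id c p U (ν k)) : GrowsAt (blockIndex ν) c p U k := by
  obtain ⟨m, hm⟩ := h
  refine ⟨m, fun y hy hmy => hm y (fun i hi => hy i ((blockIndex_lt_iff hν hk).2 hi)) ?_⟩
  rintro _ rfl
  exact hmy _ (blockIndex_eq hν le_rfl (hν k.lt_succ_self))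

end Blocks

theorem exists_strictMono_eventually_growsAt {X : Type*} [TopologicalSpace X] {c : X → ℕ → ℕ}
    (hc : IsStagedCode id c) {F : FoliageTree X}
    (hrise : ∀ p, ∀ U ∈ 𝓝 p, (F.rise p U).Nonempty ∧ ∀ n, n ∈ F.rise p U ↔ GrowsAt id c p U n)
    {γ : Set (Set ℕ)} (hcount : γ.Countable) (hγ : HasFIP γ) (hγF : PiRefines γ F.riseFamily) :
    ∃ ν : ℕ → ℕ, StrictMono ν ∧ ∀ p, ∀ U ∈ 𝓝 p, ∀ᶠ k in atTop, GrowsAt id c p U (ν k) := by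
  have hmem (p : X) (U : Set X) (hU : U ∈ 𝓝 p) : ∃ G ∈ γ, G ⊆ {n | GrowsAt id c p U n} := by
    obtain ⟨G, hG, -, hGU⟩ := hγF _ ⟨p, U, hU, rfl⟩ (hrise p U hU).1
    exact ⟨G, hG, fun n hn => ((hrise p U hU).2 n).1 (hGU hn)⟩
  obtain ⟨p, -⟩ := hc.bijective.2 0
  obtain ⟨ν, hν, hνγ⟩ := exists_strictMono_eventually_mem hcount hγ fun M =>
    let ⟨G, hG, hGM⟩ := hmem p _ (hc.stageCylinder_mem_nhds p M)
    ⟨G, hG, fun n hn => le_of_growsAt_stageCylinder hc.bijective.2 Function.surjective_id (hGM hn)⟩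
  refine ⟨ν, hν, fun p U hU => ?_⟩
  obtain ⟨G, hG, hGU⟩ := hmem p U hU
  exact (hνγ G hG).mono fun k hk => hGU hk

theorem FoliageTree.IsPiTree.exists_isStagedCode_eventually_growsAt {X : Type u}
    [TopologicalSpace X] {F : FoliageTree.{u, v} X} (hF : F.IsPiTree)
    (hγ : ∃ γ : Set (Set ℕ), γ.Countable ∧ HasFIP γ ∧ PiRefines γ F.riseFamily) :
    ∃ (stage : ℕ → ℕ) (c : X → ℕ → ℕ), IsStagedCode stage c ∧
      (∀ k, (stage ⁻¹' {k}).Nontrivial) ∧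
      ∀ p, ∀ U ∈ 𝓝 p, ∀ᶠ k in atTop, GrowsAt stage c p U k := by
  obtain ⟨c, hc, hrise⟩ := hF.exists_isStagedCode
  obtain ⟨γ, hcount, hfip, hγF⟩ := hγ
  obtain ⟨μ, hμ, hgrow⟩ := exists_strictMono_eventually_growsAt hc hrise hcount hfip hγF
  let ν (k : ℕ) : ℕ := μ (2 * k)
  have hdouble : StrictMono fun k : ℕ => 2 * k := strictMono_mul_left_of_pos two_pos
  have hν : StrictMono ν := hμ.comp hdouble
  have hgap (k : ℕ) : ν k + 2 ≤ ν (k + 1) :=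
    (Nat.succ_le_succ (hμ (2 * k).lt_succ_self)).trans (hμ (2 * k + 1).lt_succ_self)
  refine ⟨blockIndex ν, c, ⟨hc.bijective, hc.continuous, finite_blockIndex_preimage hν⟩,
    fun k => nontrivial_blockIndex_preimage hν (hgap k), fun p U hU => ?_⟩
  filter_upwards [eventually_gt_atTop 0, hdouble.tendsto_atTop.eventually (hgrow p U hU)]
    with k hk hgrow using hgrow.blockIndex hν hk

theorem mainTheorem2_general {A : Type*} [Nonempty A] [Countable A]
    (X : A → Type*) [∀ α, TopologicalSpace (X α)]
    (F : ∀ α, FoliageTree (X α)) (hF : ∀ α, (F α).IsPiTree)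
    (hγ : ∀ α, ∃ γ : Set (Set ℕ), γ.Countable ∧ HasFIP γ ∧ PiRefines γ (F α).riseFamily) :
    HasPiTree (∀ α, X α) ∧
      ∀ (Y : Type*) [TopologicalSpace Y] (G : FoliageTree Y), G.IsPiTree →
        HasPiTree (Y × ∀ α, X α) := by
  choose stage c hc hnt hgrow using fun α => (hF α).exists_isStagedCode_eventually_growsAt (hγ α)
  obtain ⟨α₀⟩ := ‹Nonempty A›
  obtain ⟨enc, henc, henc₀⟩ := exists_injective_nat_apply_eq_zero α₀
  have hpi : IsStagedCode (piStage enc stage) (piCode c) := IsStagedCode.pi henc hc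
  have hpi_nt (k : ℕ) : (piStage enc stage ⁻¹' {k}).Nontrivial :=
    nontrivial_piStage_preimage henc₀ (hnt α₀ k)
  have hpi_grow (p : ∀ α, X α) (U) (hU : U ∈ 𝓝 p) :
      ∀ᶠ k in atTop, GrowsAt (piStage enc stage) (piCode c) p U k :=
    eventually_growsAt_pi hgrow p hU
  refine ⟨hpi.hasPiTree hpi_nt fun p U hU => (hpi_grow p U hU).exists, fun Y _ G hG => ?_⟩
  obtain ⟨d, hd, hrise⟩ := hG.exists_isStagedCode
  have hd_grow (q : Y) (V) (hV : V ∈ 𝓝 q) : ∃ᶠ k in atTop, GrowsAt id d q V k :=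
    hd.frequently_growsAt Function.surjective_id
      (fun q V hV => (hrise q V hV).1.imp fun n => ((hrise q V hV).2 n).1) q hV
  exact (hd.prod hpi).hasPiTree
    (fun k => ((hpi_nt k).image Sum.inr_injective).mono (image_subset_iff.2 subset_rfl))
    fun x U hU => (frequently_growsAt_prod hd_grow hpi_grow x hU).exists

theorem mainTheorem2 {A : Type*} [Nonempty A] [Countable A]
    (X : A → Type*) [∀ α, TopologicalSpace (X α)]
    (F : ∀ α, FoliageTree (X α)) (hF : ∀ α, (F α).IsPiTree)
    (hγ : ∀ α, ∃ γ : Set (Set ℕ), γ.Countable ∧ HasFIP γ ∧ PiRefines γ (F α).riseFamily) :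
    HasPiTree (∀ α, X α) ∧
      ∀ (Y : Type*) [TopologicalSpace Y] (G : FoliageTree Y), G.IsPiTree →
        HasFIP G.riseFamily → HasPiTree (Y × ∀ α, X α) :=
  let ⟨hpi, hprod⟩ := mainTheorem2_general X F hF hγ
  ⟨hpi, fun Y _ G hG _ => hprod Y G hG⟩
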